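/- Let $L$ be a first-order signature (possibly with constants and with $0$-ary predicates). Models are $L$-structures with non-empty domain; equality is a logical symbol. A *second-order sentence* over $L$ is a formula without free variables built from equations and predicate atoms by $\neg,\wedge,\vee,\to$ and by quantifiers over individuals, over functions and over relations of every finite arity; it is interpreted in the standard (full) semantics. The formulas of *intuitionistic dependence logic* (ID) over $L$ are given by the grammar $$\phi ::= \alpha \mid {=}(t) \mid \bot \mid \phi\wedge\phi \mid \phi\mathbin{\underline{\vee}}\phi \mid \phi\to\phi \mid \forall x\,\phi \mid \exists x\,\phi ,$$ where $\alpha$ is a first-order atomic formula of $L$ and $t$ is a term of $L$. A *team* $X$ of a model $M$ is a set of assignments into $M$ with a common finite domain of variables; $s(a/x)$ denotes the assignment that maps $x$ to $a$ and otherwise agrees with $s$ (its domain is that of $s$ together with $x$), and $s(t)$ the value of $t$ under $s$. Satisfaction $M\models_X\phi$, for teams $X$ whose domain contains the free variables of $\phi$, is defined as follows: - $M\models_X\alpha$ iff every $s\in X$ satisfies $\alpha$ in the usual sense; $M\models_X{=}(t)$ iff $s(t)=s'(t)$ for all $s,s'\in X$; $M\models_X\bot$ iff $X=\emptyset$; -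 $M\models_X\phi\wedge\psi$ iff $M\models_X\phi$ and $M\models_X\psi$; $M\models_X\phi\mathbin{\underline{\vee}}\psi$ iff $M\models_X\phi$ or $M\models_X\psi$; $M\models_X\phi\to\psi$ iff for every $Y\subseteq X$, $M\models_Y\phi$ implies $M\models_Y\psi$; - $M\models_X\exists x\,\phi$ iff there is a function $F:X\to M$ with $M\models_{X(F/x)}\phi$, where $X(F/x)=\{s(F(s)/x): s\in X\}$; $M\models_X\forall x\,\phi$ iff $M\models_{X(M/x)}\phi$, where $X(M/x)=\{s(a/x): s\in X,\ a\in M\}$. **Theorem.** For every second-order sentence $\psi$ over $L$ there is an ID sentence $\phi$ over $L$ (a formula of ID without free variables) such that for every model $M$ of signature $L$, $$M\models\psi \iff M\models_{\{\emptyset\}}\phi ,$$ where $\{\emptyset\}$ is the team consisting of the empty assignment only. -/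

import Mathlib

universe u v w

namespace TeamLogic

/-! ### Second-order logic

Individual variables are natural numbers; for every arity `k` there are function variables and
relation variables of arity `k`, again numbered by natural numbers. -/

/-- Variables of second-order logic. -/
inductive SOVar : Type
  | ind (x : ℕ)
  | fn (k i : ℕ)
  | rel (k i : ℕ)

/-- Terms of second-order logic over the signature `L`. -/
inductive SOTerm (L : FirstOrder.Language.{u, v}) : Type u
  | var (x : ℕ) : SOTerm L
  | func {k : ℕ} (f : L.Functions k) (ts : Fin k → SOTerm L) : SOTerm L
  | fnVar (k i : ℕ) (ts : Fin k → SOTerm L) : SOTerm L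

/-- Formulas of second-order logic over the signature `L`. -/
inductive SOFormula (L : FirstOrder.Language.{u, v}) : Type (max u v)
  | eq (t₁ t₂ : SOTerm L) : SOFormula L
  | rel {k : ℕ} (R : L.Relations k) (ts : Fin k → SOTerm L) : SOFormula L
  | relVar (k i : ℕ) (ts : Fin k → SOTerm L) : SOFormula L
  | not (φ : SOFormula L) : SOFormula L
  | and (φ ψ : SOFormula L) : SOFormula L
  | or (φ ψ : SOFormula L) : SOFormula L
  | imp (φ ψ : SOFormula L) : SOFormula L
  | all (x : ℕ) (φ : SOFormula L) : SOFormula L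
  | ex (x : ℕ) (φ : SOFormula L) : SOFormula L
  | allFn (k i : ℕ) (φ : SOFormula L) : SOFormula L
  | exFn (k i : ℕ) (φ : SOFormula L) : SOFormula L
  | allRel (k i : ℕ) (φ : SOFormula L) : SOFormula L
  | exRel (k i : ℕ) (φ : SOFormula L) : SOFormula L

/-- A valuation of all (individual, function and relation) variables in `M`. -/
structure SOVal (M : Type w) where
  ind : ℕ → M
  fn : (k i : ℕ) → (Fin k → M) → M
  rel : (k i : ℕ) → (Fin k → M) → Prop

namespace SOVal

variable {M : Type w}

/-- Change the value of the individual variable `x` to `a`. -/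
def setInd (V : SOVal M) (x : ℕ) (a : M) : SOVal M :=
  { V with ind := Function.update V.ind x a }

/-- Change the value of the `i`-th function variable of arity `k` to `F`. -/
def setFn (V : SOVal M) (k i : ℕ) (F : (Fin k → M) → M) : SOVal M :=
  { V with fn := Function.update V.fn k (Function.update (V.fn k) i F) }

/-- Change the value of the `i`-th relation variable of arity `k` to `R`. -/
def setRel (V : SOVal M) (k i : ℕ) (R : (Fin k → M) → Prop) : SOVal M :=
  { V with rel := Function.update V.rel k (Function.update (V.rel k) i R) }

end SOVal

namespace SOTerm

variable {L : FirstOrder.Language.{u, v}}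

/-- The variables occurring in a term. -/
def vars : SOTerm L → Set SOVar
  | var x => {SOVar.ind x}
  | func _ ts => ⋃ j, (ts j).vars
  | fnVar k i ts => {SOVar.fn k i} ∪ ⋃ j, (ts j).vars

/-- The value of a term under a valuation. -/
def eval {M : Type w} [L.Structure M] (V : SOVal M) : SOTerm L → M
  | var x => V.ind x
  | func f ts => FirstOrder.Language.Structure.funMap f (fun j => (ts j).eval V)
  | fnVar k i ts => V.fn k i (fun j => (ts j).eval V)

end SOTerm

namespace SOFormula

variable {L : FirstOrder.Language.{u, v}}

/-- The free (individual, function and relation) variables of a formula. -/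
def freeVars : SOFormula L → Set SOVar
  | eq t₁ t₂ => t₁.vars ∪ t₂.vars
  | rel _ ts => ⋃ j, (ts j).vars
  | relVar k i ts => {SOVar.rel k i} ∪ ⋃ j, (ts j).vars
  | not φ => φ.freeVars
  | and φ ψ => φ.freeVars ∪ ψ.freeVars
  | or φ ψ => φ.freeVars ∪ ψ.freeVars
  | imp φ ψ => φ.freeVars ∪ ψ.freeVars
  | all x φ => φ.freeVars \ {SOVar.ind x}
  | ex x φ => φ.freeVars \ {SOVar.ind x}
  | allFn k i φ => φ.freeVars \ {SOVar.fn k i}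
  | exFn k i φ => φ.freeVars \ {SOVar.fn k i}
  | allRel k i φ => φ.freeVars \ {SOVar.rel k i}
  | exRel k i φ => φ.freeVars \ {SOVar.rel k i}

/-- A sentence is a formula without free variables of any kind. -/
def IsSentence (φ : SOFormula L) : Prop := φ.freeVars = ∅

/-- Full (standard) semantics: the second-order quantifiers range over all functions and all
relations on `M`. -/
def Realize {M : Type w} [L.Structure M] : SOFormula L → SOVal M → Prop
  | eq t₁ t₂, V => t₁.eval V = t₂.eval V
  | rel R ts, V => FirstOrder.Language.Structure.RelMap R (fun j => (ts j).eval V)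
  | relVar k i ts, V => V.rel k i (fun j => (ts j).eval V)
  | not φ, V => ¬ φ.Realize V
  | and φ ψ, V => φ.Realize V ∧ ψ.Realize V
  | or φ ψ, V => φ.Realize V ∨ ψ.Realize V
  | imp φ ψ, V => φ.Realize V → ψ.Realize V
  | all x φ, V => ∀ a : M, φ.Realize (V.setInd x a)
  | ex x φ, V => ∃ a : M, φ.Realize (V.setInd x a)
  | allFn k i φ, V => ∀ F : (Fin k → M) → M, φ.Realize (V.setFn k i F)
  | exFn k i φ, V => ∃ F : (Fin k → M) → M, φ.Realize (V.setFn k i F)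
  | allRel k i φ, V => ∀ R : (Fin k → M) → Prop, φ.Realize (V.setRel k i R)
  | exRel k i φ, V => ∃ R : (Fin k → M) → Prop, φ.Realize (V.setRel k i R)

/-- Truth of a sentence in `M`. The valuation is irrelevant for a sentence. -/
def TrueIn (φ : SOFormula L) (M : Type w) [L.Structure M] : Prop :=
  ∀ V : SOVal M, φ.Realize V

end SOFormula

/-! ### BID-logic and its intuitionistic fragment -/

/-- Formulas of BID-logic over the signature `L`, in negation normal form.
`dep ts t` is the dependence atom `=(ts₁, …, tsₙ, t)`. -/
inductive BIDFormula (L : FirstOrder.Language.{u, v}) : Type (max u v)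
  | eq (t₁ t₂ : L.Term ℕ) : BIDFormula L
  | neq (t₁ t₂ : L.Term ℕ) : BIDFormula L
  | rel {k : ℕ} (R : L.Relations k) (ts : Fin k → L.Term ℕ) : BIDFormula L
  | nrel {k : ℕ} (R : L.Relations k) (ts : Fin k → L.Term ℕ) : BIDFormula L
  | dep {n : ℕ} (ts : Fin n → L.Term ℕ) (t : L.Term ℕ) : BIDFormula L
  | ndep {n : ℕ} (ts : Fin n → L.Term ℕ) (t : L.Term ℕ) : BIDFormula L
  | bot : BIDFormula L
  | and (φ ψ : BIDFormula L) : BIDFormula L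
  | splitOr (φ ψ : BIDFormula L) : BIDFormula L
  | intOr (φ ψ : BIDFormula L) : BIDFormula L
  | intImp (φ ψ : BIDFormula L) : BIDFormula L
  | linImp (φ ψ : BIDFormula L) : BIDFormula L
  | all (x : ℕ) (φ : BIDFormula L) : BIDFormula L
  | ex (x : ℕ) (φ : BIDFormula L) : BIDFormula L

/-- An assignment on `M` with the finite domain `D`. -/
abbrev Assignment (M : Type w) (D : Finset ℕ) : Type w := D → M

/-- A team of `M` with domain `D`: a set of assignments with domain `D`. -/
abbrev Team (M : Type w) (D : Finset ℕ) : Type w := Set (Assignment M D)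

namespace Assignment

variable {M : Type w} {D : Finset ℕ}

/-- The assignment `s(a/x)`, with domain `D ∪ {x}`. -/
def update (s : Assignment M D) (x : ℕ) (a : M) : Assignment M (insert x D) := fun y =>
  if h : y.1 = x then a else s ⟨y.1, Finset.mem_of_mem_insert_of_ne y.2 h⟩

/-- The value of the term `t` under `s`. Variables outside the domain of `s` get an arbitrary
value; only terms all of whose variables are in the domain matter. -/
noncomputable def eval {L : FirstOrder.Language.{u, v}} [L.Structure M] [Nonempty M]
    (s : Assignment M D) (t : L.Term ℕ) : M :=
  t.realize (fun x => if h : x ∈ D then s ⟨x, h⟩ else Classical.arbitrary M)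

end Assignment

namespace Team

variable {M : Type w} {D : Finset ℕ}

/-- The supplement team `X(F/x)`. -/
def supplement (X : Team M D) (x : ℕ) (F : X → M) : Team M (insert x D) :=
  {s' | ∃ s : X, s' = Assignment.update s.1 x (F s)}

/-- The duplicate team `X(M/x)`. -/
def duplicate (X : Team M D) (x : ℕ) : Team M (insert x D) :=
  {s' | ∃ s ∈ X, ∃ a : M, s' = Assignment.update s x a}

end Team

namespace BIDFormula

variable {L : FirstOrder.Language.{u, v}}

/-- The free variables of a formula. -/
def freeVars : BIDFormula L → Set ℕ
  | eq t₁ t₂ => ↑t₁.varFinset ∪ ↑t₂.varFinset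
  | neq t₁ t₂ => ↑t₁.varFinset ∪ ↑t₂.varFinset
  | rel _ ts => ⋃ j, ↑(ts j).varFinset
  | nrel _ ts => ⋃ j, ↑(ts j).varFinset
  | dep ts t => (⋃ j, ↑(ts j).varFinset) ∪ ↑t.varFinset
  | ndep ts t => (⋃ j, ↑(ts j).varFinset) ∪ ↑t.varFinset
  | bot => ∅
  | and φ ψ => φ.freeVars ∪ ψ.freeVars
  | splitOr φ ψ => φ.freeVars ∪ ψ.freeVars
  | intOr φ ψ => φ.freeVars ∪ ψ.freeVars
  | intImp φ ψ => φ.freeVars ∪ ψ.freeVars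
  | linImp φ ψ => φ.freeVars ∪ ψ.freeVars
  | all x φ => φ.freeVars \ {x}
  | ex x φ => φ.freeVars \ {x}

/-- A sentence is a formula without free variables. -/
def IsSentence (φ : BIDFormula L) : Prop := φ.freeVars = ∅

/-- The formulas of intuitionistic dependence logic: built from first-order atoms, constancy
atoms `=(t)` and `⊥` by conjunction, intuitionistic disjunction, intuitionistic implication and
the quantifiers. -/
def IsID : BIDFormula L → Prop
  | eq _ _ => True
  | neq _ _ => False
  | rel _ _ => True
  | nrel _ _ => False
  | dep (n := n) _ _ => n = 0
  | ndep _ _ => False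
  | bot => True
  | and φ ψ => φ.IsID ∧ ψ.IsID
  | splitOr _ _ => False
  | intOr φ ψ => φ.IsID ∧ ψ.IsID
  | intImp φ ψ => φ.IsID ∧ ψ.IsID
  | linImp _ _ => False
  | all _ φ => φ.IsID
  | ex _ φ => φ.IsID

/-- Team semantics: the team `X` with domain `D` satisfies the formula. This is meaningful when
`D` contains all free variables of the formula. -/
def Sat {M : Type w} [L.Structure M] [Nonempty M] :
    BIDFormula L → (D : Finset ℕ) → Team M D → Prop
  | eq t₁ t₂, _, X => ∀ s ∈ X, s.eval t₁ = s.eval t₂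
  | neq t₁ t₂, _, X => ∀ s ∈ X, s.eval t₁ ≠ s.eval t₂
  | rel R ts, _, X => ∀ s ∈ X, FirstOrder.Language.Structure.RelMap R (fun j => s.eval (ts j))
  | nrel R ts, _, X => ∀ s ∈ X, ¬ FirstOrder.Language.Structure.RelMap R (fun j => s.eval (ts j))
  | dep ts t, _, X =>
      ∀ s ∈ X, ∀ s' ∈ X, (∀ j, s.eval (ts j) = s'.eval (ts j)) → s.eval t = s'.eval t
  | ndep _ _, _, X => X = ∅
  | bot, _, X => X = ∅
  | and φ ψ, D, X => φ.Sat D X ∧ ψ.Sat D X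
  | splitOr φ ψ, D, X => ∃ Y Z : Team M D, X = Y ∪ Z ∧ φ.Sat D Y ∧ ψ.Sat D Z
  | intOr φ ψ, D, X => φ.Sat D X ∨ ψ.Sat D X
  | intImp φ ψ, D, X => ∀ Y : Team M D, Y ⊆ X → φ.Sat D Y → ψ.Sat D Y
  | linImp φ ψ, D, X => ∀ Y : Team M D, φ.Sat D Y → ψ.Sat D (X ∪ Y)
  | all x φ, D, X => φ.Sat (insert x D) (X.duplicate x)
  | ex x φ, D, X => ∃ F : X → M, φ.Sat (insert x D) (X.supplement x F)

/-- Truth of a sentence in `M`: it is satisfied by the team `{∅}` that consists of the empty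
assignment. -/
def TrueIn (φ : BIDFormula L) (M : Type w) [L.Structure M] [Nonempty M] : Prop :=
  φ.Sat ∅ ({isEmptyElim} : Team M ∅)

end BIDFormula

end TeamLogic

/-! A team can store functions. Every second-order variable receives slots, and every slot has its
own argument variables and one value variable. A choice `W` of functions for all slots is stored as
the team `W.team` of all assignments in which each value variable carries the function value at the
argument variables. Arguments of different slots vary independently, so the graphs do not interfere.

Quantification over the function in a slot is first-order quantification over its value variable,
guarded by "the value depends on the arguments only". This dependence is an implication between
constancy atoms. For ∀ the guard is the premise of an intuitionistic implication: the subteams that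
pass it are exactly those inside the team of some function, and by downward closure
(`TotalSat.mono`) it suffices to test these largest teams. For ∃ the guard is a conjunct that makes
the chosen values a function of the arguments. This is `totalSat_allSlot` and `totalSat_exSlot`.

ID has no classical negation, so `SOFormula.expressible` expresses a formula and its negation
together; connectives and quantifiers dualize. Literals are flat and hence negatable; nested terms
are removed by naming their values with auxiliary elements (`subst`). A relation is stored as the
set where a function agrees with a constant, or as the complement of that set. The choice between
the two is a flag outside the team, so a relation quantifier becomes a conjunction or disjunction of
two translations. The flag is needed for one-element models, where agreement always holds.

Total assignments keep the team's domain fixed; `sat_restrict_iff` returns to finite domains. -/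

/-- Team semantics for teams of total assignments `ℕ → M`. -/
def TeamLogic.BIDFormula.TotalSat {L : FirstOrder.Language.{u, v}} {M : Type w} [L.Structure M] :
    TeamLogic.BIDFormula L → Set (ℕ → M) → Prop
  | eq t₁ t₂, X => ∀ s ∈ X, t₁.realize s = t₂.realize s
  | neq t₁ t₂, X => ∀ s ∈ X, t₁.realize s ≠ t₂.realize s
  | rel R ts, X => ∀ s ∈ X, FirstOrder.Language.Structure.RelMap R (fun j => (ts j).realize s)
  | nrel R ts, X => ∀ s ∈ X, ¬ FirstOrder.Language.Structure.RelMap R (fun j => (ts j).realize s)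
  | dep ts t, X =>
      ∀ s ∈ X, ∀ s' ∈ X, (∀ j, (ts j).realize s = (ts j).realize s') → t.realize s = t.realize s'
  | ndep _ _, X => X = ∅
  | bot, X => X = ∅
  | and φ ψ, X => φ.TotalSat X ∧ ψ.TotalSat X
  | splitOr φ ψ, X => ∃ Y Z, X = Y ∪ Z ∧ φ.TotalSat Y ∧ ψ.TotalSat Z
  | intOr φ ψ, X => φ.TotalSat X ∨ ψ.TotalSat X
  | intImp φ ψ, X => ∀ Y ⊆ X, φ.TotalSat Y → ψ.TotalSat Y
  | linImp φ ψ, X => ∀ Y, φ.TotalSat Y → ψ.TotalSat (X ∪ Y)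
  | all x φ, X => φ.TotalSat {s' | ∃ s ∈ X, ∃ a, s' = Function.update s x a}
  | ex x φ, X => ∃ F : (ℕ → M) → M, φ.TotalSat {s' | ∃ s ∈ X, s' = Function.update s x (F s)}

/-! ### Downward closure and locality -/

namespace TeamLogic

open FirstOrder

variable {L : FirstOrder.Language.{u, v}}

theorem BIDFormula.TotalSat.mono {M : Type w} [L.Structure M] {φ : BIDFormula L} (hφ : φ.IsID)
    {X Y : Set (ℕ → M)} (hYX : Y ⊆ X) (h : φ.TotalSat X) : φ.TotalSat Y := by
  induction φ generalizing X Y with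
  | eq | rel => exact fun s hs => h s (hYX hs)
  | dep => exact fun s hs s' hs' => h s (hYX hs) s' (hYX hs')
  | neq | nrel | ndep | splitOr | linImp => exact hφ.elim
  | bot => exact Set.subset_eq_empty hYX h
  | and φ ψ ih₁ ih₂ => exact ⟨ih₁ hφ.1 hYX h.1, ih₂ hφ.2 hYX h.2⟩
  | intOr φ ψ ih₁ ih₂ => exact h.imp (ih₁ hφ.1 hYX) (ih₂ hφ.2 hYX)
  | intImp φ ψ => exact fun Z hZ => h Z (hZ.trans hYX)
  | all x φ ih =>
    refine ih hφ ?_ h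
    rintro _ ⟨s, hs, a, rfl⟩
    exact ⟨s, hYX hs, a, rfl⟩
  | ex x φ ih =>
    obtain ⟨F, hF⟩ := h
    refine ⟨F, ih hφ ?_ hF⟩
    rintro _ ⟨s, hs, rfl⟩
    exact ⟨s, hYX hs, rfl⟩

/-- The restriction of a total assignment to a finite domain. -/
def Assignment.restrict {M : Type w} (D : Finset ℕ) (s : ℕ → M) : Assignment M D := fun y => s y

theorem Assignment.restrict_update {M : Type w} (D : Finset ℕ) (s : ℕ → M) (x : ℕ) (a : M) :
    restrict (insert x D) (Function.update s x a) = (restrict D s).update x a := by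
  ext y
  by_cases h : y.1 = x <;> simp [restrict, Assignment.update, h]

theorem Assignment.eval_restrict {M : Type w} [L.Structure M] [Nonempty M] {D : Finset ℕ}
    (s : ℕ → M) {t : L.Term ℕ} (ht : (t.varFinset : Set ℕ) ⊆ D) :
    (restrict D s).eval t = t.realize s := by
  unfold Assignment.eval
  induction t with
  | var x =>
    have : x ∈ D := by simpa using ht
    simp [this, restrict]
  | func f ts ih =>
    simp only [Language.Term.realize_func]
    congr 1
    ext j
    refine ih j (Set.Subset.trans ?_ ht)
    intro x hx
    simp only [Language.Term.varFinset, Finset.coe_biUnion, Set.mem_iUnion]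
    exact ⟨j, by simp, hx⟩

/-- Only the values of the free variables matter for the satisfaction of an ID formula. -/
theorem BIDFormula.sat_restrict_iff {M : Type w} [L.Structure M] [Nonempty M] {φ : BIDFormula L}
    (hφ : φ.IsID) {D : Finset ℕ} (hD : φ.freeVars ⊆ D) (X : Set (ℕ → M)) :
    φ.Sat D (Assignment.restrict D '' X) ↔ φ.TotalSat X := by
  induction φ generalizing D X with
  | eq t₁ t₂ =>
    rw [freeVars, Set.union_subset_iff] at hD
    simp [Sat, TotalSat, Assignment.eval_restrict _ hD.1, Assignment.eval_restrict _ hD.2]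
  | rel R ts =>
    rw [freeVars, Set.iUnion_subset_iff] at hD
    simp [Sat, TotalSat, Assignment.eval_restrict _ (hD _)]
  | dep ts t =>
    rw [freeVars, Set.union_subset_iff, Set.iUnion_subset_iff] at hD
    simp [Sat, TotalSat, Assignment.eval_restrict _ (hD.1 _), Assignment.eval_restrict _ hD.2]
  | neq | nrel | ndep | splitOr | linImp => exact hφ.elim
  | bot => simp [Sat, TotalSat]
  | and φ ψ ih₁ ih₂ =>
    rw [freeVars, Set.union_subset_iff] at hD
    exact and_congr (ih₁ hφ.1 hD.1 X) (ih₂ hφ.2 hD.2 X)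
  | intOr φ ψ ih₁ ih₂ =>
    rw [freeVars, Set.union_subset_iff] at hD
    exact or_congr (ih₁ hφ.1 hD.1 X) (ih₂ hφ.2 hD.2 X)
  | intImp φ ψ ih₁ ih₂ =>
    rw [freeVars, Set.union_subset_iff] at hD
    constructor
    · intro h Y hY hφY
      exact (ih₂ hφ.2 hD.2 Y).1 (h _ (Set.image_mono hY) ((ih₁ hφ.1 hD.1 Y).2 hφY))
    · intro h Y hY hφY
      obtain ⟨Y, hYX, rfl⟩ := Set.subset_image_iff.1 hY
      exact (ih₂ hφ.2 hD.2 Y).2 (h _ hYX ((ih₁ hφ.1 hD.1 Y).1 hφY))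
  | all x φ ih =>
    have hD' : φ.freeVars ⊆ (insert x D : Finset ℕ) := by
      rw [Finset.coe_insert, ← Set.sdiff_singleton_subset_iff]; exact hD
    rw [TotalSat, ← ih hφ hD', Sat]
    congr! 1
    ext s'
    constructor
    · rintro ⟨_, ⟨s, hs, rfl⟩, a, rfl⟩
      exact ⟨_, ⟨s, hs, a, rfl⟩, Assignment.restrict_update ..⟩
    · rintro ⟨_, ⟨s, hs, a, rfl⟩, rfl⟩
      exact ⟨_, ⟨s, hs, rfl⟩, a, Assignment.restrict_update ..⟩
  | ex x φ ih =>
    have hD' : φ.freeVars ⊆ (insert x D : Finset ℕ) := by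
      rw [Finset.coe_insert, ← Set.sdiff_singleton_subset_iff]; exact hD
    constructor
    · rintro ⟨F, hF⟩
      classical
      -- `G` reads `F` off the restriction; outside `X` its value is immaterial, and `s 0` is merely
      -- an available element.
      let G : (ℕ → M) → M := fun s =>
        if hs : s ∈ X then F ⟨_, Set.mem_image_of_mem _ hs⟩ else s 0
      refine ⟨G, (ih hφ hD' _).1 ?_⟩
      convert hF using 1
      ext s'
      constructor
      · rintro ⟨_, ⟨s, hs, rfl⟩, rfl⟩
        exact ⟨⟨_, Set.mem_image_of_mem _ hs⟩, by simp [Assignment.restrict_update, G, hs]⟩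
      · rintro ⟨⟨_, s, hs, rfl⟩, rfl⟩
        exact ⟨_, ⟨s, hs, rfl⟩, by simp [Assignment.restrict_update, G, hs]⟩
    · rintro ⟨G, hG⟩
      -- Assignments with the same restriction may get different values under `G`. One
      -- representative per restriction is kept, which yields a smaller team, and downward closure
      -- applies.
      choose r hrX hr using fun s : Assignment.restrict D '' X => s.2
      refine ⟨fun s => G (r s), ?_⟩
      have hsub := TotalSat.mono (φ := φ) (Y := {s' | ∃ s, s' = Function.update (r s) x (G (r s))}) hφ
        (by rintro _ ⟨s, rfl⟩; exact ⟨_, hrX s, rfl⟩) hG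
      rw [← ih hφ hD'] at hsub
      convert hsub using 1
      ext s'
      constructor
      · rintro ⟨s, rfl⟩
        exact ⟨_, ⟨s, rfl⟩, by rw [Assignment.restrict_update, hr]⟩
      · rintro ⟨_, ⟨s, rfl⟩, rfl⟩
        exact ⟨s, by rw [Assignment.restrict_update, hr]⟩

/-- Any nonempty team restricts on the empty domain to the team of the empty assignment. A sentence
may therefore be evaluated on whichever nonempty team is convenient. -/
theorem BIDFormula.trueIn_iff_totalSat {M : Type w} [L.Structure M] [Nonempty M]
    {φ : BIDFormula L} (hφ : φ.IsID) (hs : φ.IsSentence) {X : Set (ℕ → M)} (hX : X.Nonempty) :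
    φ.TrueIn M ↔ φ.TotalSat X := by
  rw [← sat_restrict_iff hφ (D := ∅) (by rw [hs]; simp), TrueIn]
  congr! 1
  obtain ⟨s, hs⟩ := hX
  ext s'
  simp only [Set.mem_singleton_iff, Set.mem_image]
  exact ⟨fun _ => ⟨s, hs, Subsingleton.elim _ _⟩, fun _ => Subsingleton.elim _ _⟩

/-! ### Derived connectives -/

namespace BIDFormula

/-- Finite conjunctions. -/
def conj : List (BIDFormula L) → BIDFormula L
  | [] => intImp bot bot
  | φ :: l => and φ (conj l)

/-- The universal quantifier over a list of variables. -/
def alls : List ℕ → BIDFormula L → BIDFormula L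
  | [], φ => φ
  | x :: l, φ => all x (alls l φ)

/-- The constancy atom of a variable. -/
def const (x : ℕ) : BIDFormula L := dep (n := 0) Fin.elim0 (Language.Term.var x)

/-- The variable `y` depends on the variables in `l` only. -/
def dependsOn (l : List ℕ) (y : ℕ) : BIDFormula L := intImp (conj (l.map const)) (const y)

/-- The formula `φ → ⊥`. -/
def neg (φ : BIDFormula L) : BIDFormula L := intImp φ bot

theorem isID_conj {l : List (BIDFormula L)} : (conj l).IsID ↔ ∀ φ ∈ l, φ.IsID := by
  induction l with
  | nil => simp [conj, IsID]
  | cons φ l ih => simp [conj, IsID, ih]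

theorem isID_alls {l : List ℕ} {φ : BIDFormula L} : (alls l φ).IsID ↔ φ.IsID := by
  induction l with
  | nil => rfl
  | cons x l ih => exact ih

theorem isID_dependsOn (l : List ℕ) (y : ℕ) : (dependsOn l y : BIDFormula L).IsID :=
  ⟨isID_conj.2 (by simp [const, IsID]), rfl⟩

theorem freeVars_conj (l : List (BIDFormula L)) :
    (conj l).freeVars = {x | ∃ φ ∈ l, x ∈ φ.freeVars} := by
  induction l with
  | nil => simp [conj, freeVars]
  | cons φ l ih => ext; simp [conj, freeVars, ih]

theorem freeVars_alls (l : List ℕ) (φ : BIDFormula L) :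
    (alls l φ).freeVars = φ.freeVars \ {x | x ∈ l} := by
  induction l with
  | nil => simp [alls]
  | cons x l ih => ext; simp [alls, freeVars, ih]; tauto

theorem freeVars_const (x : ℕ) : (const x : BIDFormula L).freeVars = {x} := by
  simp [const, freeVars]

theorem freeVars_dependsOn (l : List ℕ) (y : ℕ) :
    (dependsOn l y : BIDFormula L).freeVars = {x | x ∈ l ∨ x = y} := by
  ext; simp [dependsOn, freeVars, freeVars_conj, freeVars_const]; tauto

variable {M : Type w} [L.Structure M]

theorem totalSat_conj {l : List (BIDFormula L)} {X : Set (ℕ → M)} :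
    (conj l).TotalSat X ↔ ∀ φ ∈ l, φ.TotalSat X := by
  induction l with
  | nil => simp [conj, TotalSat]
  | cons φ l ih => simp [conj, TotalSat, ih]

theorem totalSat_alls {l : List ℕ} {φ : BIDFormula L} {X : Set (ℕ → M)} :
    (alls l φ).TotalSat X ↔ φ.TotalSat {s' | ∃ s ∈ X, ∀ y ∉ l, s' y = s y} := by
  induction l generalizing X with
  | nil =>
    simp only [alls]
    congr! 1
    ext s'
    constructor
    · exact fun h => ⟨s', h, fun _ _ => rfl⟩
    · rintro ⟨s, hs, h⟩
      rwa [show s' = s from funext fun y => h y (by simp)]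
  | cons x l ih =>
    simp only [alls, TotalSat, ih]
    congr! 1
    ext s'
    constructor
    · rintro ⟨_, ⟨s, hs, a, rfl⟩, h⟩
      refine ⟨s, hs, fun y hy => ?_⟩
      simp only [List.mem_cons, not_or] at hy
      rw [h y hy.2, Function.update_of_ne hy.1]
    · rintro ⟨s, hs, h⟩
      refine ⟨_, ⟨s, hs, s' x, rfl⟩, fun y hy => ?_⟩
      by_cases hyx : y = x
      · subst hyx; simp
      · rw [Function.update_of_ne hyx, h y (by simp [hyx, hy])]

theorem totalSat_const {x : ℕ} {X : Set (ℕ → M)} :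
    (const x : BIDFormula L).TotalSat X ↔ ∀ s ∈ X, ∀ s' ∈ X, s x = s' x := by
  simp [const, TotalSat]

theorem totalSat_dependsOn {l : List ℕ} {y : ℕ} {X : Set (ℕ → M)} :
    (dependsOn l y : BIDFormula L).TotalSat X ↔
      ∀ s ∈ X, ∀ s' ∈ X, (∀ x ∈ l, s x = s' x) → s y = s' y := by
  simp only [dependsOn, TotalSat, totalSat_conj, List.mem_map, forall_exists_index, and_imp,
    forall_apply_eq_imp_iff₂, totalSat_const]
  constructor
  · intro h s hs s' hs' hss
    -- Dependence is a condition on pairs, so two-element subteams suffice.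
    refine h {s, s'} (Set.insert_subset hs (Set.singleton_subset_iff.2 hs')) ?_ s (by simp) s'
      (by simp)
    rintro x hx t (rfl | rfl) t' (rfl | rfl) <;> simp [hss x hx]
  · exact fun h Y hY hl s hs s' hs' => h s (hY hs) s' (hY hs') fun x hx => hl x hx s hs s' hs'

/-! ### Flat formulas -/

/-- A formula is flat on `M` if its satisfaction by teams is given by a condition on single
assignments. -/
def FlatWith (M : Type w) [L.Structure M] (φ : BIDFormula L) (p : (ℕ → M) → Prop) : Prop :=
  ∀ X : Set (ℕ → M), φ.TotalSat X ↔ ∀ s ∈ X, p s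

/-- Testing the implication on singletons gives the pointwise condition. Hence on flat formulas
`neg` acts as classical negation at each assignment. -/
theorem FlatWith.intImp {φ ψ : BIDFormula L} {p q : (ℕ → M) → Prop} (hφ : φ.FlatWith M p)
    (hψ : ψ.FlatWith M q) : (φ.intImp ψ).FlatWith M fun s => p s → q s := by
  intro X
  simp only [TotalSat, hφ _, hψ _]
  constructor
  · intro h s hs hp
    exact h {s} (by simpa using hs) (by simpa using hp) s rfl
  · exact fun h Y hY hp s hs => h s (hY hs) (hp s hs)

theorem flatWith_bot : (bot : BIDFormula L).FlatWith M fun _ => False := by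
  intro X
  simp [TotalSat, Set.eq_empty_iff_forall_notMem]

theorem FlatWith.neg {φ : BIDFormula L} {p : (ℕ → M) → Prop} (hφ : φ.FlatWith M p) :
    φ.neg.FlatWith M fun s => ¬ p s :=
  hφ.intImp flatWith_bot

end BIDFormula

/-! ### Slots: the functions that a team encodes -/

/-- Slots for functions: the individual variables, the function variables, a function and an
element for every relation variable, and auxiliary elements. -/
inductive Slot : Type
  | ind (x : ℕ)
  | fn (k i : ℕ)
  | rel (k i : ℕ)
  | sep (k i : ℕ)
  | aux (n : ℕ)

namespace Slot

/-- The arity of the function in a slot. -/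
abbrev arity : Slot → ℕ
  | ind _ => 0
  | fn k _ => k
  | rel k _ => k
  | sep _ _ => 0
  | aux _ => 0

/-- A numbering of the slots. -/
def code : Slot → ℕ
  | ind x => 5 * x
  | fn k i => 5 * Nat.pair k i + 1
  | rel k i => 5 * Nat.pair k i + 2
  | sep k i => 5 * Nat.pair k i + 3
  | aux n => 5 * n + 4

theorem code_injective : Function.Injective code := by
  intro p q h
  cases p <;> cases q <;> simp only [code] at h <;> first
    | omega
    | (simp only [ind.injEq, fn.injEq, rel.injEq, sep.injEq, aux.injEq, ← Nat.pair_eq_pair]; omega)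

/-- The first-order variable for the value of the function in the slot `p`. -/
def val (p : Slot) : ℕ := Nat.pair p.code 0

/-- The first-order variables for the arguments of the function in the slot `p`. -/
def arg (p : Slot) (j : ℕ) : ℕ := Nat.pair p.code (j + 1)

theorem val_inj {p q : Slot} : p.val = q.val ↔ p = q := by
  simp [val, Nat.pair_eq_pair, code_injective.eq_iff]

theorem arg_inj {p q : Slot} {i j : ℕ} : p.arg i = q.arg j ↔ p = q ∧ i = j := by
  simp [arg, Nat.pair_eq_pair, code_injective.eq_iff]

theorem val_ne_arg {p q : Slot} {j : ℕ} : p.val ≠ q.arg j := by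
  simp [arg, val, Nat.pair_eq_pair]

theorem arg_ne_val {p q : Slot} {j : ℕ} : p.arg j ≠ q.val := val_ne_arg.symm

/-- The list of the argument variables of a slot. -/
def args (p : Slot) : List ℕ := List.ofFn fun j : Fin p.arity => p.arg j

theorem mem_args {p : Slot} {x : ℕ} : x ∈ p.args ↔ ∃ j : Fin p.arity, p.arg j = x := by
  simp [args, List.mem_ofFn]

/-- All first-order variables of the slots in `S`. -/
def varsOf (S : Set Slot) : Set ℕ := {x | ∃ p ∈ S, x = p.val ∨ x ∈ p.args}

theorem varsOf_mono {S S' : Set Slot} (h : S ⊆ S') : varsOf S ⊆ varsOf S' :=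
  fun _ ⟨p, hp, hx⟩ => ⟨p, h hp, hx⟩

theorem val_mem_varsOf {S : Set Slot} {p : Slot} (hp : p ∈ S) : p.val ∈ varsOf S :=
  ⟨p, hp, Or.inl rfl⟩

theorem args_mem_varsOf {S : Set Slot} {p : Slot} (hp : p ∈ S) {x : ℕ} (hx : x ∈ p.args) :
    x ∈ varsOf S :=
  ⟨p, hp, Or.inr hx⟩

end Slot

/-! ### Teams that encode slot valuations -/

/-- A choice of functions for all slots. -/
abbrev SlotVal (M : Type w) : Type w := (p : Slot) → (Fin p.arity → M) → M

/-- The total team that encodes a choice of functions for all slots. -/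
def SlotVal.team {M : Type w} (W : SlotVal M) : Set (ℕ → M) :=
  {s | ∀ p : Slot, s p.val = W p fun j => s (p.arg j)}

/-- Every choice of arguments is realized in the team. -/
theorem SlotVal.exists_mem_team {M : Type w} (W : SlotVal M) (b : Slot → ℕ → M) :
    ∃ s ∈ W.team, ∀ p j, s (Slot.arg p j) = b p j := by
  classical
  -- Arguments are prescribed by `b`, values are then computed by `W`; the last branch is only a
  -- formal default.
  let s : ℕ → M := fun x =>
    if h : ∃ q : Slot × ℕ, x = q.1.arg q.2 then b h.choose.1 h.choose.2
    else if h : ∃ q : Slot, x = q.val then W h.choose fun j => b h.choose j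
    else b (Slot.aux 0) 0
  have hs : ∀ p j, s (Slot.arg p j) = b p j := by
    intro p j
    have h : ∃ q : Slot × ℕ, p.arg j = q.1.arg q.2 := ⟨(p, j), rfl⟩
    have h' := Slot.arg_inj.1 h.choose_spec
    simp only [s, dif_pos h]
    rw [← h'.1, ← h'.2]
  refine ⟨s, fun p => ?_, hs⟩
  simp only [hs]
  have h₁ : ¬ ∃ q : Slot × ℕ, p.val = q.1.arg q.2 := fun ⟨q, hq⟩ => Slot.val_ne_arg hq
  have h : ∃ q : Slot, p.val = q.val := ⟨p, rfl⟩
  have h' := Slot.val_inj.1 h.choose_spec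
  simp only [s, dif_neg h₁, dif_pos h]
  rw [← h']

theorem SlotVal.team_nonempty {M : Type w} [Nonempty M] (W : SlotVal M) : W.team.Nonempty := by
  obtain ⟨s, hs, -⟩ := W.exists_mem_team fun _ _ => Classical.arbitrary M
  exact ⟨s, hs⟩

open Classical in
/-- Change the function in the slot `p`. -/
noncomputable def SlotVal.set {M : Type w} (W : SlotVal M) (p : Slot)
    (G : (Fin p.arity → M) → M) : SlotVal M :=
  Function.update W p G

theorem SlotVal.set_self {M : Type w} (W : SlotVal M) (p : Slot) (G : (Fin p.arity → M) → M) :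
    W.set p G p = G := by
  simp [SlotVal.set]

theorem SlotVal.set_of_ne {M : Type w} (W : SlotVal M) {p q : Slot} (G : (Fin p.arity → M) → M)
    (h : q ≠ p) : W.set p G q = W q := by
  simp [SlotVal.set, h]

theorem SlotVal.mem_team_set {M : Type w} {W : SlotVal M} {p : Slot}
    {G : (Fin p.arity → M) → M} {s : ℕ → M} :
    s ∈ (W.set p G).team ↔
      (∀ q ≠ p, s q.val = W q fun j => s (q.arg j)) ∧ s p.val = G fun j => s (p.arg j) := by
  constructor
  · intro h
    refine ⟨fun q hq => ?_, ?_⟩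
    · rw [h q, SlotVal.set_of_ne _ _ hq]
    · rw [h p, SlotVal.set_self]
  · rintro ⟨h₁, h₂⟩ q
    by_cases hq : q = p
    · subst hq; rw [SlotVal.set_self, h₂]
    · rw [SlotVal.set_of_ne _ _ hq, h₁ q hq]

/-- Assignments that agree with an assignment in the team outside the variables of `p`. -/
theorem SlotVal.eq_of_agree {M : Type w} {W : SlotVal M} {p : Slot} {s s' : ℕ → M}
    (hs : s ∈ W.team) (h : ∀ y, y ≠ p.val → y ∉ p.args → s' y = s y) (q : Slot) (hq : q ≠ p) :
    s' q.val = W q fun j => s' (q.arg j) := by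
  have hargs : ∀ j, s' (q.arg j) = s (q.arg j) := fun j => h _ Slot.arg_ne_val fun hj => by
    obtain ⟨i, hi⟩ := Slot.mem_args.1 hj
    exact hq (Slot.arg_inj.1 hi).1.symm
  simp only [hargs]
  rw [h, hs q]
  · exact fun h => hq (Slot.val_inj.1 h)
  · intro hj
    obtain ⟨i, hi⟩ := Slot.mem_args.1 hj
    exact Slot.arg_ne_val hi

/-- No other slot uses `p.val`, so resetting it repairs the one constraint that may fail. This gives
the member of the old team from which quantification recovers `s`. -/
theorem SlotVal.update_val_mem_team {M : Type w} {W : SlotVal M} {p : Slot} {s : ℕ → M}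
    (h : ∀ q ≠ p, s q.val = W q fun j => s (q.arg j)) :
    Function.update s p.val (W p fun j => s (p.arg j)) ∈ W.team := by
  intro q
  simp only [Function.update_of_ne (Slot.arg_ne_val)]
  by_cases hq : q = p
  · subst hq; simp
  · rw [Function.update_of_ne (fun h => hq (Slot.val_inj.1 h)), h q hq]

/-- A team in which the value of `p` depends on the arguments only is contained in the team of a
function. -/
theorem SlotVal.exists_fn_of_dependsOn {M : Type w} [Nonempty M] {p : Slot} {Y : Set (ℕ → M)}
    (h : ∀ s ∈ Y, ∀ s' ∈ Y, (∀ x ∈ p.args, s x = s' x) → s p.val = s' p.val) :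
    ∃ G : (Fin p.arity → M) → M, ∀ s ∈ Y, s p.val = G fun j => s (p.arg j) := by
  classical
  -- At argument tuples that do not occur in `Y` the function is arbitrary.
  let G : (Fin p.arity → M) → M := fun a =>
    if h : ∃ s ∈ Y, ∀ j : Fin p.arity, s (p.arg j) = a j then h.choose p.val
    else Classical.arbitrary M
  refine ⟨G, fun s hs => ?_⟩
  have h' : ∃ s' ∈ Y, ∀ j : Fin p.arity, s' (p.arg j) = s (p.arg j) := ⟨s, hs, fun _ => rfl⟩
  simp only [G, dif_pos h']
  refine h s hs _ h'.choose_spec.1 fun x hx => ?_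
  obtain ⟨j, rfl⟩ := Slot.mem_args.1 hx
  exact (h'.choose_spec.2 j).symm

/-! ### Quantifiers over functions -/

namespace BIDFormula

/-- Universal quantification over the function in the slot `p`. -/
def allSlot (p : Slot) (φ : BIDFormula L) : BIDFormula L :=
  alls p.args (all p.val (intImp (dependsOn p.args p.val) φ))

/-- Existential quantification over the function in the slot `p`. -/
def exSlot (p : Slot) (φ : BIDFormula L) : BIDFormula L :=
  alls p.args (ex p.val (and (dependsOn p.args p.val) φ))

theorem isID_allSlot {p : Slot} {φ : BIDFormula L} (hφ : φ.IsID) : (allSlot p φ).IsID :=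
  isID_alls.2 ⟨isID_dependsOn _ _, hφ⟩

theorem isID_exSlot {p : Slot} {φ : BIDFormula L} (hφ : φ.IsID) : (exSlot p φ).IsID :=
  isID_alls.2 ⟨isID_dependsOn _ _, hφ⟩

theorem freeVars_allSlot {p : Slot} {φ : BIDFormula L} {S : Set Slot}
    (h : φ.freeVars ⊆ Slot.varsOf S) : (allSlot p φ).freeVars ⊆ Slot.varsOf (S \ {p}) := by
  intro x hx
  simp only [allSlot, freeVars_alls, freeVars, freeVars_dependsOn, Set.mem_sdiff, Set.mem_union,
    Set.mem_ofPred_eq, Set.mem_singleton_iff] at hx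
  obtain ⟨⟨hx₁, hx₂⟩, hx₃⟩ := hx
  obtain ⟨q, hq, hxq⟩ := h (hx₁.resolve_left (by tauto))
  refine ⟨q, ⟨hq, ?_⟩, hxq⟩
  rintro rfl
  tauto

theorem freeVars_exSlot {p : Slot} {φ : BIDFormula L} {S : Set Slot}
    (h : φ.freeVars ⊆ Slot.varsOf S) : (exSlot p φ).freeVars ⊆ Slot.varsOf (S \ {p}) := by
  have := freeVars_allSlot (p := p) h
  simp only [allSlot, exSlot, freeVars_alls, freeVars] at this ⊢
  exact this

variable {M : Type w} [L.Structure M] [Nonempty M]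

/-- After the quantifiers the team is constrained at all slots but `p`. Each `(W.set p G).team` is a
subteam satisfying the dependence, and conversely every such subteam lies in one of these, so `mono`
finishes. On `W.team` the arguments already vary freely; quantifying them serves to bind them. -/
theorem totalSat_allSlot {p : Slot} {φ : BIDFormula L} (hφ : φ.IsID) (W : SlotVal M) :
    (allSlot p φ).TotalSat W.team ↔ ∀ G, φ.TotalSat (W.set p G).team := by
  rw [allSlot, totalSat_alls]
  simp only [TotalSat, totalSat_dependsOn]
  constructor
  · intro h G
    refine h _ ?_ ?_
    · intro s hs
      rw [SlotVal.mem_team_set] at hs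
      refine ⟨_, ⟨_, SlotVal.update_val_mem_team hs.1, fun _ _ => rfl⟩, s p.val, ?_⟩
      simp
    · intro s hs s' hs' hss
      rw [SlotVal.mem_team_set] at hs hs'
      rw [hs.2, hs'.2]
      congr 1
      ext j
      exact hss _ (Slot.mem_args.2 ⟨j, rfl⟩)
  · intro h Y hY hdep
    obtain ⟨G, hG⟩ := SlotVal.exists_fn_of_dependsOn hdep
    refine (h G).mono hφ fun s hs => SlotVal.mem_team_set.2 ⟨?_, hG s hs⟩
    obtain ⟨s₁, ⟨s₀, hs₀, h₁⟩, a, rfl⟩ := hY hs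
    refine SlotVal.eq_of_agree hs₀ fun y hy hy' => ?_
    rw [Function.update_of_ne hy, h₁ y hy']

/-- The choice function sees the whole assignment, and the dependence conjunct reduces it to a
function of the arguments. Each direction needs one inclusion between the supplemented team and
`(W.set p G).team`. -/
theorem totalSat_exSlot {p : Slot} {φ : BIDFormula L} (hφ : φ.IsID) (W : SlotVal M) :
    (exSlot p φ).TotalSat W.team ↔ ∃ G, φ.TotalSat (W.set p G).team := by
  rw [exSlot, totalSat_alls]
  simp only [TotalSat, totalSat_dependsOn]
  constructor
  · rintro ⟨F, hdep, h⟩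
    obtain ⟨G, hG⟩ := SlotVal.exists_fn_of_dependsOn hdep
    refine ⟨G, h.mono hφ fun s hs => ?_⟩
    rw [SlotVal.mem_team_set] at hs
    set s₀ := Function.update s p.val (W p fun j => s (p.arg j)) with hs₀
    have hmem : Function.update s₀ p.val (F s₀) ∈ {s' | ∃ s₁ ∈ {s₁ | ∃ s₂ ∈ W.team,
        ∀ y ∉ p.args, s₁ y = s₂ y}, s' = Function.update s₁ p.val (F s₁)} :=
      ⟨s₀, ⟨s₀, SlotVal.update_val_mem_team hs.1, fun _ _ => rfl⟩, rfl⟩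
    have hval := hG _ hmem
    -- The value chosen at `s₀` is `G` of its arguments. These are the arguments of `s`, so the
    -- supplemented assignment is `s` itself.
    have : Function.update s₀ p.val (F s₀) = s := by
      simp only [hs₀, Function.update_idem, Function.update_self,
        Function.update_of_ne Slot.arg_ne_val] at hval ⊢
      rw [hval, ← hs.2, Function.update_eq_self]
    rwa [this] at hmem
  · rintro ⟨G, hG⟩
    have key : ∀ s ∈ {s' | ∃ s₁ ∈ {s₁ | ∃ s₂ ∈ W.team, ∀ y ∉ p.args, s₁ y = s₂ y},
        s' = Function.update s₁ p.val (G fun j => s₁ (p.arg j))}, s ∈ (W.set p G).team := by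
      rintro _ ⟨s₁, ⟨s₂, hs₂, h₁⟩, rfl⟩
      refine SlotVal.mem_team_set.2 ⟨SlotVal.eq_of_agree hs₂ fun y hy hy' => ?_, ?_⟩
      · rw [Function.update_of_ne hy, h₁ y hy']
      · simp only [Function.update_self, Function.update_of_ne Slot.arg_ne_val]
    refine ⟨fun s => G fun j => s (p.arg j), ?_, hG.mono hφ key⟩
    intro s hs s' hs' hss
    rw [(SlotVal.mem_team_set.1 (key s hs)).2, (SlotVal.mem_team_set.1 (key s' hs')).2]
    congr 1
    ext j
    exact hss _ (Slot.mem_args.2 ⟨j, rfl⟩)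

end BIDFormula

/-! ### Expressible properties -/

/-- A property of slot valuations, for all structures. -/
abbrev SlotProp (L : FirstOrder.Language.{u, v}) : Type (max u v (w + 1)) :=
  ∀ (M : Type w) [L.Structure M] [Nonempty M], SlotVal M → Prop

/-- The property `P` is expressed by an ID formula whose free variables belong to the slots in
`S`. -/
def Expressible (L : FirstOrder.Language.{u, v}) (S : Set Slot) (P : SlotProp.{u, v, w} L) : Prop :=
  ∃ φ : BIDFormula L, φ.IsID ∧ φ.freeVars ⊆ Slot.varsOf S ∧
    ∀ (M : Type w) [L.Structure M] [Nonempty M] (W : SlotVal M), φ.TotalSat W.team ↔ P M W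

namespace Expressible

variable {S S₁ S₂ : Set Slot} {P Q : SlotProp.{u, v, w} L}

theorem congr (h : Expressible L S P) (hS : S ⊆ S₁)
    (hPQ : ∀ (M : Type w) [L.Structure M] [Nonempty M] (W : SlotVal M), P M W ↔ Q M W) :
    Expressible L S₁ Q := by
  obtain ⟨φ, h₁, h₂, h₃⟩ := h
  exact ⟨φ, h₁, h₂.trans (Slot.varsOf_mono hS), fun M _ _ W => (h₃ M W).trans (hPQ M W)⟩

theorem and (hP : Expressible L S P) (hQ : Expressible L S Q) :
    Expressible L S fun M _ _ W => P M W ∧ Q M W := by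
  obtain ⟨φ, h₁, h₂, h₃⟩ := hP
  obtain ⟨ψ, k₁, k₂, k₃⟩ := hQ
  exact ⟨φ.and ψ, ⟨h₁, k₁⟩, Set.union_subset h₂ k₂, fun M _ _ W => and_congr (h₃ M W) (k₃ M W)⟩

/-- Intuitionistic disjunction decides for the whole team at once. Since the team encodes a single
`W`, this is the classical disjunction of properties of `W`. -/
theorem or (hP : Expressible L S P) (hQ : Expressible L S Q) :
    Expressible L S fun M _ _ W => P M W ∨ Q M W := by
  obtain ⟨φ, h₁, h₂, h₃⟩ := hP
  obtain ⟨ψ, k₁, k₂, k₃⟩ := hQ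
  exact ⟨φ.intOr ψ, ⟨h₁, k₁⟩, Set.union_subset h₂ k₂, fun M _ _ W => or_congr (h₃ M W) (k₃ M W)⟩

theorem all (p : Slot) (hP : Expressible L S P) :
    Expressible L (S \ {p}) fun M _ _ W => ∀ G, P M (W.set p G) := by
  obtain ⟨φ, h₁, h₂, h₃⟩ := hP
  exact ⟨φ.allSlot p, BIDFormula.isID_allSlot h₁, BIDFormula.freeVars_allSlot h₂,
    fun M _ _ W => (BIDFormula.totalSat_allSlot h₁ W).trans (forall_congr' fun G => h₃ M _)⟩

theorem ex (p : Slot) (hP : Expressible L S P) :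
    Expressible L (S \ {p}) fun M _ _ W => ∃ G, P M (W.set p G) := by
  obtain ⟨φ, h₁, h₂, h₃⟩ := hP
  exact ⟨φ.exSlot p, BIDFormula.isID_exSlot h₁, BIDFormula.freeVars_exSlot h₂,
    fun M _ _ W => (BIDFormula.totalSat_exSlot h₁ W).trans (exists_congr fun G => h₃ M _)⟩

/-- A flat formula expresses its truth for all assignments in the team. -/
theorem of_flatWith {φ : BIDFormula L} (hφ : φ.IsID) (hS : φ.freeVars ⊆ Slot.varsOf S)
    {p : ∀ (M : Type w) [L.Structure M] [Nonempty M], (ℕ → M) → Prop}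
    (hp : ∀ (M : Type w) [L.Structure M] [Nonempty M], φ.FlatWith M (p M))
    (hP : ∀ (M : Type w) [L.Structure M] [Nonempty M] (W : SlotVal M),
      (∀ s ∈ W.team, p M s) ↔ P M W) : Expressible L S P :=
  ⟨φ, hφ, hS, fun M _ _ W => (hp M _).trans (hP M W)⟩

end Expressible

/-! ### Second-order valuations encoded by slot valuations -/

/-- The second-order variable that a slot serves. -/
def Slot.owner : Slot → Option SOVar
  | ind x => some (SOVar.ind x)
  | fn k i => some (SOVar.fn k i)
  | rel k i => some (SOVar.rel k i)
  | sep k i => some (SOVar.rel k i)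
  | aux _ => none

/-- The slots that serve the variables in `S`. -/
def slotsOf (S : Set SOVar) : Set Slot := {q | ∃ v ∈ S, q.owner = some v}

theorem slotsOf_mono {S S' : Set SOVar} (h : S ⊆ S') : slotsOf S ⊆ slotsOf S' :=
  fun _ ⟨v, hv, hq⟩ => ⟨v, h hv, hq⟩

theorem mem_slotsOf {S : Set SOVar} {q : Slot} {v : SOVar} (hv : v ∈ S) (h : q.owner = some v) :
    q ∈ slotsOf S :=
  ⟨v, hv, h⟩

theorem mem_slotsOf_diff {S : Set SOVar} {q : Slot} {v : SOVar} (hq : q ∈ slotsOf S)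
    (h : q.owner ≠ some v) : q ∈ slotsOf (S \ {v}) := by
  obtain ⟨v', hv', hq⟩ := hq
  refine ⟨v', ⟨hv', ?_⟩, hq⟩
  rintro rfl
  exact h hq

theorem SOVal.eq_of_components {M : Type w} {V V' : SOVal M} (h₁ : V.ind = V'.ind)
    (h₂ : V.fn = V'.fn) (h₃ : V.rel = V'.rel) : V = V' := by
  cases V; cases V'; simp_all

namespace SlotVal

variable {M : Type w}

/-- The second-order valuation encoded by a slot valuation. The flag `e k i` tells whether a
relation holds where the two values that represent it agree, or where they differ. -/
def decode (e : ℕ → ℕ → Bool) (W : SlotVal M) : SOVal M where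
  ind x := W (Slot.ind x) Fin.elim0
  fn k i := W (Slot.fn k i)
  rel k i a := W (Slot.rel k i) a = W (Slot.sep k i) Fin.elim0 ↔ e k i = true

theorem decode_set_aux (e : ℕ → ℕ → Bool) (W : SlotVal M) (n : ℕ) (G) :
    (W.set (Slot.aux n) G).decode e = W.decode e := by
  simp [decode, SlotVal.set]

theorem decode_set_ind (e : ℕ → ℕ → Bool) (W : SlotVal M) (x : ℕ) (G) :
    (W.set (Slot.ind x) G).decode e = (W.decode e).setInd x (G Fin.elim0) := by
  refine SOVal.eq_of_components (funext fun y => ?_) ?_ ?_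
  · simp only [decode, SOVal.setInd]
    by_cases h : y = x
    · subst h; simp [set_self]
    · rw [set_of_ne _ _ (by simpa using h), Function.update_of_ne h]
  · ext; simp [decode, SOVal.setInd, SlotVal.set]
  · ext; simp [decode, SOVal.setInd, SlotVal.set]

theorem decode_set_fn (e : ℕ → ℕ → Bool) (W : SlotVal M) (k i : ℕ) (G) :
    (W.set (Slot.fn k i) G).decode e = (W.decode e).setFn k i G := by
  refine SOVal.eq_of_components ?_ (funext fun k' => funext fun i' => ?_) ?_
  · ext; simp [decode, SOVal.setFn, SlotVal.set]
  · simp only [decode, SOVal.setFn]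
    by_cases hk : k' = k
    · subst hk
      by_cases hi : i' = i
      · subst hi; simp [set_self]
      · rw [set_of_ne _ _ (by simpa using hi)]; simp [hi]
    · rw [set_of_ne _ _ (by simp [hk]), Function.update_of_ne hk]
  · ext; simp [decode, SOVal.setFn, SlotVal.set]

/-- Changing a relation touches two slots of the team and the flag, which belongs to the
translation. -/
theorem decode_set_rel (e : ℕ → ℕ → Bool) (W : SlotVal M) (k i : ℕ) (b : Bool) (F C) :
    ((W.set (Slot.rel k i) F).set (Slot.sep k i) C).decode
        (Function.update e k (Function.update (e k) i b)) =
      (W.decode e).setRel k i fun a => F a = C Fin.elim0 ↔ b = true := by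
  refine SOVal.eq_of_components ?_ ?_ (funext fun k' => funext fun i' => ?_)
  · ext; simp [decode, SOVal.setRel, SlotVal.set]
  · ext; simp [decode, SOVal.setRel, SlotVal.set]
  · simp only [decode, SOVal.setRel]
    by_cases hk : k' = k
    · subst hk
      by_cases hi : i' = i
      · subst hi
        simp [set_self, set_of_ne _ _ (show Slot.rel k' i' ≠ Slot.sep k' i' by simp)]
      · simp [SlotVal.set, hi]
    · simp [SlotVal.set, hk]

end SlotVal

/-- Every relation is the agreement relation or the disagreement relation of a function and a
constant. -/
theorem exists_eq_iff_of_rel {α : Type*} {M : Type w} [Nonempty M] (R : (α → M) → Prop) :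
    ∃ (b : Bool) (F : (α → M) → M) (c : M), R = fun a => F a = c ↔ b = true := by
  classical
  by_cases hM : ∃ x y : M, x ≠ y
  · obtain ⟨x, y, hxy⟩ := hM
    refine ⟨true, fun a => if R a then x else y, x, ?_⟩
    ext a
    by_cases h : R a <;> simp [h, hxy.symm]
  · push Not at hM
    let c := Classical.arbitrary M
    -- With one element there is one argument tuple and agreement always holds; the flag alone
    -- records whether `R` does.
    refine ⟨decide (R fun _ => c), fun _ => c, c, ?_⟩
    ext a
    rw [show a = fun _ => c from funext fun _ => hM _ _]
    simp

/-! ### Atomic properties -/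

theorem BIDFormula.flatWith_eq {M : Type w} [L.Structure M] (t₁ t₂ : L.Term ℕ) :
    (eq t₁ t₂).FlatWith M fun s => t₁.realize s = t₂.realize s :=
  fun _ => Iff.rfl

theorem BIDFormula.flatWith_rel {M : Type w} [L.Structure M] {k : ℕ} (R : L.Relations k)
    (ts : Fin k → L.Term ℕ) :
    (rel R ts).FlatWith M fun s => Language.Structure.RelMap R fun j => (ts j).realize s :=
  fun _ => Iff.rfl

/-- The formula saying that the arguments of the slot `p` are the auxiliary elements from `n`
on. -/
def BIDFormula.argsEqAux (p : Slot) (n : ℕ) : BIDFormula L :=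
  conj (List.ofFn fun j : Fin p.arity =>
    eq (Language.Term.var (p.arg j)) (Language.Term.var (Slot.aux (n + j)).val))

theorem BIDFormula.flatWith_argsEqAux {M : Type w} [L.Structure M] (p : Slot) (n : ℕ) :
    (argsEqAux p n : BIDFormula L).FlatWith M
      fun s => ∀ j : Fin p.arity, s (p.arg j) = s (Slot.aux (n + j)).val := by
  intro X
  simp only [argsEqAux, totalSat_conj, List.mem_ofFn, forall_exists_index,
    forall_apply_eq_imp_iff, TotalSat, Language.Term.realize_var]
  exact ⟨fun h s hs j => h j s hs, fun h j s hs => h s hs j⟩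

/-- The auxiliary slots `n, …, n + k - 1`. -/
def auxSlots (n k : ℕ) : Set Slot := {q | ∃ j < k, q = Slot.aux (n + j)}

theorem BIDFormula.freeVars_argsEqAux (p : Slot) (n : ℕ) :
    (argsEqAux p n : BIDFormula L).freeVars ⊆ Slot.varsOf ({p} ∪ auxSlots n p.arity) := by
  intro x hx
  simp only [argsEqAux, freeVars_conj, List.mem_ofFn, Set.mem_ofPred_eq] at hx
  obtain ⟨_, ⟨j, rfl⟩, hx⟩ := hx
  simp only [freeVars, Language.Term.varFinset, Finset.coe_singleton, Set.mem_union,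
    Set.mem_singleton_iff] at hx
  rcases hx with rfl | rfl
  · exact Slot.args_mem_varsOf (Or.inl rfl) (Slot.mem_args.2 ⟨j, rfl⟩)
  · exact Slot.val_mem_varsOf (Or.inr ⟨j, j.2, rfl⟩)

/-- Slots of arity zero are constant on the team. The empty tuple `z` is left free so that any form
of it matches. -/
theorem SlotVal.apply_of_mem_team {M : Type w} {W : SlotVal M} {s : ℕ → M} (hs : s ∈ W.team)
    {q : Slot} (hq : q.arity = 0) (z : Fin q.arity → M) : s q.val = W q z := by
  rw [hs q]
  congr 1
  ext j
  exact (Fin.cast hq j).elim0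

theorem SlotVal.aux_of_mem_team {M : Type w} {W : SlotVal M} {s : ℕ → M} (hs : s ∈ W.team)
    (n : ℕ) : s (Slot.aux n).val = W (Slot.aux n) Fin.elim0 :=
  SlotVal.apply_of_mem_team hs rfl _

namespace Expressible

open BIDFormula

/-- The whole graph of the function in `p` is in the team. The premise `argsEqAux` singles out the
assignments whose arguments are the auxiliary elements, and `χ` is tested only there. -/
theorem apply_eq_of_flatWith (p q : Slot) (hq : q.arity = 0) (z : ∀ M : Type w, Fin q.arity → M)
    (n : ℕ) {χ : BIDFormula L} {r : ∀ {M : Type w}, M → M → Prop} (hχ : χ.IsID)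
    (hfree : χ.freeVars ⊆ {p.val, q.val})
    (hr : ∀ (M : Type w) [L.Structure M] [Nonempty M],
      χ.FlatWith M fun s => r (s p.val) (s q.val)) :
    Expressible L ({p, q} ∪ auxSlots n p.arity) fun M _ _ W =>
      r (W p fun j => W (Slot.aux (n + j)) Fin.elim0) (W q (z M)) := by
  refine of_flatWith (φ := (argsEqAux p n).intImp χ) ⟨isID_conj.2 ?_, hχ⟩ ?_
    (fun M _ _ => (flatWith_argsEqAux p n).intImp (hr M)) ?_
  · simp [List.mem_ofFn, IsID]
  · refine Set.union_subset ((freeVars_argsEqAux p n).trans (Slot.varsOf_mono ?_))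
      (hfree.trans ?_)
    · exact Set.union_subset_union_left _ (by simp)
    · rintro x (rfl | rfl)
      · exact Slot.val_mem_varsOf (by simp)
      · exact Slot.val_mem_varsOf (by simp)
  · intro M _ _ W
    constructor
    · intro h
      -- An assignment with the required arguments exists, so the implication is not vacuous.
      obtain ⟨s, hs, hb⟩ := W.exists_mem_team fun _ j => W (Slot.aux (n + j)) Fin.elim0
      have := h s hs fun j => by rw [hb, SlotVal.aux_of_mem_team hs]
      rw [SlotVal.apply_of_mem_team hs hq (z M), hs p] at this
      simpa only [hb] using this
    · intro h s hs hargs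
      rw [SlotVal.apply_of_mem_team hs hq (z M), hs p]
      simpa only [hargs, SlotVal.aux_of_mem_team hs] using h

theorem apply_eq (p q : Slot) (hq : q.arity = 0) (z : ∀ M : Type w, Fin q.arity → M) (n : ℕ) :
    Expressible L ({p, q} ∪ auxSlots n p.arity) fun M _ _ W =>
      (W p fun j => W (Slot.aux (n + j)) Fin.elim0) = W q (z M) :=
  apply_eq_of_flatWith p q hq z n (r := fun a b => a = b)
    (χ := .eq (Language.Term.var p.val) (Language.Term.var q.val)) trivial
    (by simp [freeVars, Set.pair_comm]) fun M _ _ => flatWith_eq _ _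

theorem apply_ne (p q : Slot) (hq : q.arity = 0) (z : ∀ M : Type w, Fin q.arity → M) (n : ℕ) :
    Expressible L ({p, q} ∪ auxSlots n p.arity) fun M _ _ W =>
      ¬ (W p fun j => W (Slot.aux (n + j)) Fin.elim0) = W q (z M) :=
  apply_eq_of_flatWith p q hq z n (r := fun a b => ¬ a = b)
    (χ := (BIDFormula.eq (Language.Term.var p.val) (Language.Term.var q.val)).neg)
    ⟨trivial, trivial⟩ (by simp [neg, freeVars, Set.pair_comm])
    fun M _ _ => (flatWith_eq _ _).neg

theorem relMap {k : ℕ} (R : L.Relations k) (n : ℕ) :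
    Expressible.{u, v, w} L (auxSlots n k) fun _ _ _ W =>
      Language.Structure.RelMap R fun j : Fin k => W (Slot.aux (n + j)) Fin.elim0 := by
  refine of_flatWith (φ := .rel R fun j => Language.Term.var (Slot.aux (n + j)).val) trivial ?_
    (fun M _ _ => flatWith_rel _ _) ?_
  · refine Set.iUnion_subset fun j => ?_
    simpa using Slot.val_mem_varsOf (S := auxSlots n k) ⟨j, j.2, rfl⟩
  · intro M _ _ W
    obtain ⟨s₀, hs₀⟩ := W.team_nonempty
    constructor
    · intro h
      simpa only [Language.Term.realize_var, SlotVal.aux_of_mem_team hs₀] using h s₀ hs₀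
    · intro h s hs
      simpa only [Language.Term.realize_var, SlotVal.aux_of_mem_team hs] using h

theorem not_relMap {k : ℕ} (R : L.Relations k) (n : ℕ) :
    Expressible.{u, v, w} L (auxSlots n k) fun _ _ _ W =>
      ¬ Language.Structure.RelMap R fun j : Fin k => W (Slot.aux (n + j)) Fin.elim0 := by
  refine of_flatWith
    (φ := (BIDFormula.rel R fun j => Language.Term.var (Slot.aux (n + j)).val).neg)
    ⟨trivial, trivial⟩ ?_ (fun M _ _ => (flatWith_rel _ _).neg) ?_
  · refine Set.union_subset (Set.iUnion_subset fun j => ?_) (Set.empty_subset _)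
    simpa using Slot.val_mem_varsOf (S := auxSlots n k) ⟨j, j.2, rfl⟩
  · intro M _ _ W
    obtain ⟨s₀, hs₀⟩ := W.team_nonempty
    constructor
    · intro h
      simpa only [Language.Term.realize_var, SlotVal.aux_of_mem_team hs₀] using h s₀ hs₀
    · intro h s hs
      simpa only [Language.Term.realize_var, SlotVal.aux_of_mem_team hs] using h

theorem funMap {k : ℕ} (f : L.Functions k) (c n : ℕ) :
    Expressible.{u, v, w} L ({Slot.aux c} ∪ auxSlots n k) fun _ _ _ W =>
      W (Slot.aux c) Fin.elim0 =
        Language.Structure.funMap f fun j : Fin k => W (Slot.aux (n + j)) Fin.elim0 := by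
  refine of_flatWith (φ := .eq (Language.Term.var (Slot.aux c).val)
    (Language.Term.func f fun j => Language.Term.var (Slot.aux (n + j)).val)) trivial ?_
    (fun M _ _ => flatWith_eq _ _) ?_
  · refine Set.union_subset ?_ ?_
    · simpa using Slot.val_mem_varsOf (Or.inl rfl)
    · intro x hx
      simp only [Language.Term.varFinset, Finset.coe_biUnion, Set.mem_iUnion,
        Finset.coe_singleton, Set.mem_singleton_iff] at hx
      obtain ⟨j, -, rfl⟩ := hx
      exact Slot.val_mem_varsOf (Or.inr ⟨j, j.2, rfl⟩)
  · intro M _ _ W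
    obtain ⟨s₀, hs₀⟩ := W.team_nonempty
    constructor
    · intro h
      simpa only [Language.Term.realize_func, Language.Term.realize_var,
        SlotVal.aux_of_mem_team hs₀] using h s₀ hs₀
    · intro h s hs
      simpa only [Language.Term.realize_func, Language.Term.realize_var,
        SlotVal.aux_of_mem_team hs] using h

/-! ### Terms -/

/-- The property that an auxiliary element is the value of a term. -/
def AuxEqTerm (e : ℕ → ℕ → Bool) (t : SOTerm L) : Prop :=
  ∀ c, Expressible.{u, v, w} L ({Slot.aux c} ∪ slotsOf t.vars) fun _ _ _ W =>
    W (Slot.aux c) Fin.elim0 = t.eval (W.decode e)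

/-- A property of auxiliary elements may be applied to the values of terms. -/
theorem subst {e : ℕ → ℕ → Bool} {k : ℕ} {ts : Fin k → SOTerm L}
    (hts : ∀ j, AuxEqTerm.{u, v, w} e (ts j)) {n : ℕ} {S : Set Slot}
    {A : ∀ (M : Type w) [L.Structure M] [Nonempty M], SlotVal M → (Fin k → M) → Prop}
    (hA : ∀ (M : Type w) [L.Structure M] [Nonempty M] (W : SlotVal M) (m : ℕ) (G) (b : Fin k → M),
      n ≤ m → (A M (W.set (Slot.aux m) G) b ↔ A M W b))
    (h : Expressible L (S ∪ auxSlots n k) fun M _ _ W =>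
      A M W fun j => W (Slot.aux (n + j)) Fin.elim0) :
    Expressible L (S ∪ slotsOf (⋃ j, (ts j).vars)) fun M _ _ W =>
      A M W fun j => (ts j).eval (W.decode e) := by
  -- Arguments are replaced from the last to the first: those below `m` are still auxiliary
  -- elements. The case `m = k` is the hypothesis, `m = 0` the goal.
  have key : ∀ d m, m + d = k →
      Expressible L (S ∪ slotsOf (⋃ j, (ts j).vars) ∪ auxSlots n m) fun M _ _ W =>
        A M W fun j => if (j : ℕ) < m then W (Slot.aux (n + j)) Fin.elim0
          else (ts j).eval (W.decode e) := by
    intro d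
    induction d with
    | zero =>
      rintro m rfl
      refine h.congr (Set.union_subset_union_left _ Set.subset_union_left) ?_
      intro M _ _ W
      simp
    | succ d ih =>
      intro m hm
      have h₁ := ih (m + 1) (by omega)
      have hmk : m < k := by omega
      have h₂ := (hts ⟨m, hmk⟩ (n + m)).congr
        (S₁ := S ∪ slotsOf (⋃ j, (ts j).vars) ∪ auxSlots n (m + 1))
        (Set.union_subset ?_ ?_) fun M _ _ W => Iff.rfl
      -- "Some element equals the term and satisfies the property"; the quantifier also removes this
      -- auxiliary slot from the free ones.
      · refine ((h₂.and h₁).ex (Slot.aux (n + m))).congr ?_ ?_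
        · rintro q ⟨hq | ⟨j, hj, rfl⟩, hq'⟩
          · exact Or.inl hq
          · refine Or.inr ⟨j, lt_of_le_of_ne (by omega) ?_, rfl⟩
            rintro rfl
            exact hq' rfl
        · intro M _ _ W
          simp only [SlotVal.set_self, SlotVal.decode_set_aux, hA M W _ _ _ (Nat.le_add_right n m)]
          have heq : ∀ G : (Fin (Slot.aux (n + m)).arity → M) → M,
              G Fin.elim0 = (ts ⟨m, hmk⟩).eval (W.decode e) →
              (fun j : Fin k => if (j : ℕ) < m + 1 then
                W.set (Slot.aux (n + m)) G (Slot.aux (n + j)) Fin.elim0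
                else (ts j).eval (W.decode e)) =
              fun j : Fin k => if (j : ℕ) < m then W (Slot.aux (n + j)) Fin.elim0
                else (ts j).eval (W.decode e) := by
            intro G hG
            ext j
            rcases lt_trichotomy (j : ℕ) m with hj | hj | hj
            · rw [if_pos (by omega), if_pos hj, SlotVal.set_of_ne]
              simpa using hj.ne
            · obtain rfl : j = ⟨m, hmk⟩ := Fin.ext hj
              simp [SlotVal.set_self, hG]
            · rw [if_neg (by omega), if_neg (by omega)]
          constructor
          · rintro ⟨G, hG, h⟩
            rwa [heq G hG] at h
          · intro h
            refine ⟨fun _ => (ts ⟨m, hmk⟩).eval (W.decode e), rfl, ?_⟩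
            rwa [heq _ rfl]
      · rintro _ rfl
        exact Or.inr ⟨m, by omega, rfl⟩
      · exact (slotsOf_mono (Set.subset_iUnion (fun j => (ts j).vars) ⟨m, hmk⟩)).trans
          (Set.subset_union_right.trans Set.subset_union_left)
  refine (key k 0 (by omega)).congr ?_ ?_
  · rintro q (hq | ⟨j, hj, -⟩)
    · exact hq
    · omega
  · intro M _ _ W
    simp

theorem auxEqTerm (e : ℕ → ℕ → Bool) (t : SOTerm L) : AuxEqTerm.{u, v, w} e t := by
  induction t with
  | var x =>
    intro c
    refine (apply_eq (Slot.aux c) (Slot.ind x) rfl (fun _ => Fin.elim0) 0).congr ?_ ?_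
    · rintro q ((rfl | rfl) | ⟨j, hj, -⟩)
      · exact Or.inl rfl
      · exact Or.inr (mem_slotsOf rfl rfl)
      · exact (Nat.not_lt_zero _ hj).elim
    · intro M _ _ W
      rw [show (fun j : Fin (Slot.aux c).arity => W (Slot.aux (0 + j)) Fin.elim0) = Fin.elim0 from
        funext fun j => j.elim0]
      rfl
  | @func k f ts ih =>
    intro c
    -- Starting at `c + 1` keeps the names of the arguments apart from the name `c` of the value.
    exact subst ih (n := c + 1) (A := fun M _ _ W b => W (Slot.aux c) Fin.elim0 =
        Language.Structure.funMap f b)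
      (fun M _ _ W m G b hm => by rw [SlotVal.set_of_ne]; simp; omega) (funMap f c (c + 1))
  | fnVar k i ts ih =>
    intro c
    refine (subst ih (n := c + 1) (S := {Slot.fn k i, Slot.aux c})
      (A := fun M _ _ W b => W (Slot.fn k i) b = W (Slot.aux c) Fin.elim0)
      (fun M _ _ W m G b hm => ?_)
      (apply_eq (Slot.fn k i) (Slot.aux c) rfl (fun _ => Fin.elim0) (c + 1))).congr ?_ ?_
    · rw [SlotVal.set_of_ne, SlotVal.set_of_ne]
      · simp; omega
      · simp
    · rintro q ((rfl | rfl) | hq)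
      · exact Or.inr (mem_slotsOf (Or.inl rfl) rfl)
      · exact Or.inl rfl
      · exact Or.inr (slotsOf_mono Set.subset_union_right hq)
    · exact fun M _ _ W => eq_comm

end Expressible

/-! ### Formulas -/

open Expressible in
/-- Every second-order formula and its negation are expressible. -/
theorem SOFormula.expressible (ψ : SOFormula L) (e : ℕ → ℕ → Bool) :
    Expressible.{u, v, w} L (slotsOf ψ.freeVars) (fun _ _ _ W => ψ.Realize (W.decode e)) ∧
    Expressible.{u, v, w} L (slotsOf ψ.freeVars) (fun _ _ _ W => ¬ ψ.Realize (W.decode e)) := by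
  induction ψ generalizing e with
  | eq t₁ t₂ =>
    have hts : ∀ j, AuxEqTerm.{u, v, w} e (![t₁, t₂] j) := fun j => auxEqTerm e _
    have hsub : ∅ ∪ slotsOf (⋃ j, (![t₁, t₂] j).vars) ⊆ slotsOf (SOFormula.eq t₁ t₂).freeVars := by
      rw [Set.empty_union]
      refine slotsOf_mono (Set.iUnion_subset fun j => ?_)
      fin_cases j
      · exact Set.subset_union_left
      · exact Set.subset_union_right
    have hsub' : {Slot.aux 0, Slot.aux 1} ∪ auxSlots 0 (Slot.aux 0).arity ⊆
        ∅ ∪ auxSlots 0 2 := by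
      rintro q ((rfl | rfl) | ⟨j, hj, -⟩)
      · exact Or.inr ⟨0, by omega, rfl⟩
      · exact Or.inr ⟨1, by omega, rfl⟩
      · exact (Nat.not_lt_zero _ hj).elim
    have hz : ∀ (M : Type w) (W : SlotVal M), (fun j : Fin (Slot.aux 0).arity =>
        W (Slot.aux (0 + j)) Fin.elim0) = Fin.elim0 := fun M W => funext fun j => j.elim0
    constructor
    · exact (subst hts (n := 0) (A := fun M _ _ W b => b 0 = b 1) (fun _ _ _ _ _ _ _ _ => Iff.rfl)
        ((apply_eq (Slot.aux 0) (Slot.aux 1) rfl (fun _ => Fin.elim0) 0).congr hsub'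
          fun M _ _ W => by rw [hz]; rfl)).congr hsub fun M _ _ W => Iff.rfl
    · exact (subst hts (n := 0) (A := fun M _ _ W b => ¬ b 0 = b 1)
        (fun _ _ _ _ _ _ _ _ => Iff.rfl)
        ((apply_ne (Slot.aux 0) (Slot.aux 1) rfl (fun _ => Fin.elim0) 0).congr hsub'
          fun M _ _ W => by rw [hz]; rfl)).congr hsub fun M _ _ W => Iff.rfl
  | @rel k R ts =>
    constructor
    · exact (subst (S := ∅) (fun j => auxEqTerm e (ts j)) (n := 0)
        (A := fun M _ _ W b => Language.Structure.RelMap R b) (fun _ _ _ _ _ _ _ _ => Iff.rfl)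
        ((relMap R 0).congr Set.subset_union_right fun M _ _ W => Iff.rfl)).congr
        (by rw [Set.empty_union]; rfl) fun M _ _ W => Iff.rfl
    · exact (subst (S := ∅) (fun j => auxEqTerm e (ts j)) (n := 0)
        (A := fun M _ _ W b => ¬ Language.Structure.RelMap R b) (fun _ _ _ _ _ _ _ _ => Iff.rfl)
        ((not_relMap R 0).congr Set.subset_union_right fun M _ _ W => Iff.rfl)).congr
        (by rw [Set.empty_union]; rfl) fun M _ _ W => Iff.rfl
  | relVar k i ts =>
    have hsub : {Slot.rel k i, Slot.sep k i} ∪ slotsOf (⋃ j, (ts j).vars) ⊆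
        slotsOf (SOFormula.relVar k i ts : SOFormula L).freeVars := by
      rintro q ((rfl | rfl) | hq)
      · exact mem_slotsOf (Or.inl rfl) rfl
      · exact mem_slotsOf (Or.inl rfl) rfl
      · exact slotsOf_mono Set.subset_union_right hq
    have h₁ := subst (fun j => auxEqTerm e (ts j)) (n := 0)
      (A := fun M _ _ W b => W (Slot.rel k i) b = W (Slot.sep k i) Fin.elim0)
      (fun M _ _ W m G b _ => by rw [SlotVal.set_of_ne _ _ (by simp), SlotVal.set_of_ne _ _ (by simp)])
      (apply_eq (Slot.rel k i) (Slot.sep k i) rfl (fun _ => Fin.elim0) 0)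
    have h₂ := subst (fun j => auxEqTerm e (ts j)) (n := 0)
      (A := fun M _ _ W b => ¬ W (Slot.rel k i) b = W (Slot.sep k i) Fin.elim0)
      (fun M _ _ W m G b _ => by rw [SlotVal.set_of_ne _ _ (by simp), SlotVal.set_of_ne _ _ (by simp)])
      (apply_ne (Slot.rel k i) (Slot.sep k i) rfl (fun _ => Fin.elim0) 0)
    -- The flag decides whether the equation or its negation expresses the atom; the other one
    -- expresses the negated atom.
    cases he : e k i
    · exact ⟨h₂.congr hsub fun M _ _ W => by simp [Realize, SlotVal.decode, he],
        h₁.congr hsub fun M _ _ W => by simp [Realize, SlotVal.decode, he]⟩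
    · exact ⟨h₁.congr hsub fun M _ _ W => by simp [Realize, SlotVal.decode, he],
        h₂.congr hsub fun M _ _ W => by simp [Realize, SlotVal.decode, he]⟩
  | not φ ih =>
    exact ⟨(ih e).2, (ih e).1.congr subset_rfl fun M _ _ W => not_not.symm⟩
  | and φ ψ ih₁ ih₂ =>
    have hl : slotsOf φ.freeVars ⊆ slotsOf (φ.and ψ).freeVars := slotsOf_mono Set.subset_union_left
    have hr : slotsOf ψ.freeVars ⊆ slotsOf (φ.and ψ).freeVars := slotsOf_mono Set.subset_union_right
    exact ⟨((ih₁ e).1.congr hl fun M _ _ W => Iff.rfl).and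
        ((ih₂ e).1.congr hr fun M _ _ W => Iff.rfl),
      (((ih₁ e).2.congr hl fun M _ _ W => Iff.rfl).or
        ((ih₂ e).2.congr hr fun M _ _ W => Iff.rfl)).congr subset_rfl
        fun M _ _ W => not_and_or.symm⟩
  | or φ ψ ih₁ ih₂ =>
    have hl : slotsOf φ.freeVars ⊆ slotsOf (φ.or ψ).freeVars := slotsOf_mono Set.subset_union_left
    have hr : slotsOf ψ.freeVars ⊆ slotsOf (φ.or ψ).freeVars := slotsOf_mono Set.subset_union_right
    exact ⟨((ih₁ e).1.congr hl fun M _ _ W => Iff.rfl).or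
        ((ih₂ e).1.congr hr fun M _ _ W => Iff.rfl),
      (((ih₁ e).2.congr hl fun M _ _ W => Iff.rfl).and
        ((ih₂ e).2.congr hr fun M _ _ W => Iff.rfl)).congr subset_rfl
        fun M _ _ W => not_or.symm⟩
  | imp φ ψ ih₁ ih₂ =>
    have hl : slotsOf φ.freeVars ⊆ slotsOf (φ.imp ψ).freeVars := slotsOf_mono Set.subset_union_left
    have hr : slotsOf ψ.freeVars ⊆ slotsOf (φ.imp ψ).freeVars := slotsOf_mono Set.subset_union_right
    exact ⟨(((ih₁ e).2.congr hl fun M _ _ W => Iff.rfl).or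
        ((ih₂ e).1.congr hr fun M _ _ W => Iff.rfl)).congr subset_rfl
        fun M _ _ W => imp_iff_not_or.symm,
      (((ih₁ e).1.congr hl fun M _ _ W => Iff.rfl).and
        ((ih₂ e).2.congr hr fun M _ _ W => Iff.rfl)).congr subset_rfl
        fun M _ _ W => Classical.not_imp.symm⟩
  | all x φ ih =>
    have hsub : slotsOf φ.freeVars \ {Slot.ind x} ⊆ slotsOf (SOFormula.all x φ).freeVars :=
      fun q hq => mem_slotsOf_diff hq.1 fun h => hq.2 (by cases q <;> simp_all [Slot.owner])
    refine ⟨((ih e).1.all (Slot.ind x)).congr hsub fun M _ _ W => ?_,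
      ((ih e).2.ex (Slot.ind x)).congr hsub fun M _ _ W => ?_⟩
    · simp only [Realize, SlotVal.decode_set_ind]
      exact ⟨fun h a => h fun _ => a, fun h G => h _⟩
    · simp only [Realize, SlotVal.decode_set_ind, not_forall]
      exact ⟨fun ⟨G, h⟩ => ⟨_, h⟩, fun ⟨a, h⟩ => ⟨fun _ => a, h⟩⟩
  | ex x φ ih =>
    have hsub : slotsOf φ.freeVars \ {Slot.ind x} ⊆ slotsOf (SOFormula.ex x φ).freeVars :=
      fun q hq => mem_slotsOf_diff hq.1 fun h => hq.2 (by cases q <;> simp_all [Slot.owner])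
    refine ⟨((ih e).1.ex (Slot.ind x)).congr hsub fun M _ _ W => ?_,
      ((ih e).2.all (Slot.ind x)).congr hsub fun M _ _ W => ?_⟩
    · simp only [Realize, SlotVal.decode_set_ind]
      exact ⟨fun ⟨G, h⟩ => ⟨_, h⟩, fun ⟨a, h⟩ => ⟨fun _ => a, h⟩⟩
    · simp only [Realize, SlotVal.decode_set_ind, not_exists]
      exact ⟨fun h a => h fun _ => a, fun h G => h _⟩
  | allFn k i φ ih =>
    have hsub : slotsOf φ.freeVars \ {Slot.fn k i} ⊆ slotsOf (SOFormula.allFn k i φ).freeVars :=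
      fun q hq => mem_slotsOf_diff hq.1 fun h => hq.2 (by cases q <;> simp_all [Slot.owner])
    refine ⟨((ih e).1.all (Slot.fn k i)).congr hsub fun M _ _ W => ?_,
      ((ih e).2.ex (Slot.fn k i)).congr hsub fun M _ _ W => ?_⟩
    · simp only [Realize, SlotVal.decode_set_fn]
    · simp only [Realize, SlotVal.decode_set_fn, not_forall]
  | exFn k i φ ih =>
    have hsub : slotsOf φ.freeVars \ {Slot.fn k i} ⊆ slotsOf (SOFormula.exFn k i φ).freeVars :=
      fun q hq => mem_slotsOf_diff hq.1 fun h => hq.2 (by cases q <;> simp_all [Slot.owner])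
    refine ⟨((ih e).1.ex (Slot.fn k i)).congr hsub fun M _ _ W => ?_,
      ((ih e).2.all (Slot.fn k i)).congr hsub fun M _ _ W => ?_⟩
    · simp only [Realize, SlotVal.decode_set_fn]
    · simp only [Realize, SlotVal.decode_set_fn, not_exists]
  | allRel k i φ ih =>
    have hsub : (slotsOf φ.freeVars \ {Slot.sep k i}) \ {Slot.rel k i} ⊆
        slotsOf (SOFormula.allRel k i φ).freeVars := fun q hq => mem_slotsOf_diff hq.1.1 fun h => by
      have h₁ := hq.1.2
      have h₂ := hq.2
      cases q <;> simp_all [Slot.owner]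
    -- The body is translated once for each flag of the quantified relation, which is why the
    -- induction generalizes `e`. Together the two translations cover every relation, by
    -- `exists_eq_iff_of_rel`.
    let e' : Bool → ℕ → ℕ → Bool := fun b => Function.update e k (Function.update (e k) i b)
    have pos := fun b => (((ih (e' b)).1.all (Slot.sep k i)).all (Slot.rel k i))
    have neg := fun b => (((ih (e' b)).2.ex (Slot.sep k i)).ex (Slot.rel k i))
    have key : ∀ {M : Type w} [L.Structure M] (W : SlotVal M) (b : Bool) F C,
        φ.Realize (((W.set (Slot.rel k i) F).set (Slot.sep k i) C).decode (e' b)) ↔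
          φ.Realize ((W.decode e).setRel k i fun a => F a = C Fin.elim0 ↔ b = true) := by
      intro M _ W b F C
      rw [SlotVal.decode_set_rel]
    refine ⟨((pos true).and (pos false)).congr hsub fun M _ _ W => ?_,
      ((neg true).or (neg false)).congr hsub fun M _ _ W => ?_⟩
    · constructor
      · rintro ⟨ht, hf⟩ R
        obtain ⟨b, F, c, rfl⟩ := exists_eq_iff_of_rel R
        cases b
        · exact (key W _ _ _).1 (hf F fun _ => c)
        · exact (key W _ _ _).1 (ht F fun _ => c)
      · exact fun h => ⟨fun F C => (key W _ _ _).2 (h _), fun F C => (key W _ _ _).2 (h _)⟩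
    · rw [Realize, not_forall]
      constructor
      · rintro (⟨F, C, h⟩ | ⟨F, C, h⟩)
        · exact ⟨_, mt (key W _ _ _).2 h⟩
        · exact ⟨_, mt (key W _ _ _).2 h⟩
      · rintro ⟨R, h⟩
        obtain ⟨b, F, c, rfl⟩ := exists_eq_iff_of_rel R
        cases b
        · exact Or.inr ⟨F, fun _ => c, mt (key W _ _ _).1 h⟩
        · exact Or.inl ⟨F, fun _ => c, mt (key W _ _ _).1 h⟩

  | exRel k i φ ih =>
    have hsub : (slotsOf φ.freeVars \ {Slot.sep k i}) \ {Slot.rel k i} ⊆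
        slotsOf (SOFormula.exRel k i φ).freeVars := fun q hq => mem_slotsOf_diff hq.1.1 fun h => by
      have h₁ := hq.1.2
      have h₂ := hq.2
      cases q <;> simp_all [Slot.owner]
    let e' : Bool → ℕ → ℕ → Bool := fun b => Function.update e k (Function.update (e k) i b)
    have pos := fun b => (((ih (e' b)).1.ex (Slot.sep k i)).ex (Slot.rel k i))
    have neg := fun b => (((ih (e' b)).2.all (Slot.sep k i)).all (Slot.rel k i))
    have key : ∀ {M : Type w} [L.Structure M] (W : SlotVal M) (b : Bool) F C,
        φ.Realize (((W.set (Slot.rel k i) F).set (Slot.sep k i) C).decode (e' b)) ↔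
          φ.Realize ((W.decode e).setRel k i fun a => F a = C Fin.elim0 ↔ b = true) := by
      intro M _ W b F C
      rw [SlotVal.decode_set_rel]
    refine ⟨((pos true).or (pos false)).congr hsub fun M _ _ W => ?_,
      ((neg true).and (neg false)).congr hsub fun M _ _ W => ?_⟩
    · constructor
      · rintro (⟨F, C, h⟩ | ⟨F, C, h⟩)
        · exact ⟨_, (key W _ _ _).1 h⟩
        · exact ⟨_, (key W _ _ _).1 h⟩
      · rintro ⟨R, h⟩
        obtain ⟨b, F, c, rfl⟩ := exists_eq_iff_of_rel R
        cases b
        · exact Or.inr ⟨F, fun _ => c, (key W _ _ _).2 h⟩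
        · exact Or.inl ⟨F, fun _ => c, (key W _ _ _).2 h⟩
    · rw [Realize, not_exists]
      constructor
      · rintro ⟨ht, hf⟩ R hR
        obtain ⟨b, F, c, rfl⟩ := exists_eq_iff_of_rel R
        cases b
        · exact hf F (fun _ => c) ((key W _ _ _).2 hR)
        · exact ht F (fun _ => c) ((key W _ _ _).2 hR)
      · exact fun h => ⟨fun F C hR => h _ ((key W _ _ _).1 hR),
          fun F C hR => h _ ((key W _ _ _).1 hR)⟩

/-! ### Dependence on the free variables -/

/-- Two valuations agree on a variable. -/
def SOVal.Agree {M : Type w} (V V' : SOVal M) : SOVar → Prop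
  | .ind x => V.ind x = V'.ind x
  | .fn k i => V.fn k i = V'.fn k i
  | .rel k i => V.rel k i = V'.rel k i

namespace SOVal

variable {M : Type w} {V V' : SOVal M} {S : Set SOVar}

theorem agree_setInd {x : ℕ} (h : ∀ v ∈ S \ {SOVar.ind x}, V.Agree V' v) (a : M) :
    ∀ v ∈ S, (V.setInd x a).Agree (V'.setInd x a) v := by
  intro v hv
  by_cases hx : v = SOVar.ind x
  · subst hx; simp [Agree, setInd]
  · have := h v ⟨hv, hx⟩
    cases v with
    | ind y => simpa [Agree, setInd, show y ≠ x by simpa using hx] using this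
    | fn | rel => exact this

theorem agree_setFn {k i : ℕ} (h : ∀ v ∈ S \ {SOVar.fn k i}, V.Agree V' v)
    (F : (Fin k → M) → M) : ∀ v ∈ S, (V.setFn k i F).Agree (V'.setFn k i F) v := by
  intro v hv
  by_cases hx : v = SOVar.fn k i
  · subst hx; simp [Agree, setFn]
  · have := h v ⟨hv, hx⟩
    cases v with
    | fn k' i' =>
      by_cases hk : k' = k
      · subst hk
        simpa [Agree, setFn, show i' ≠ i by simpa using hx] using this
      · simpa [Agree, setFn, hk] using this
    | ind | rel => exact this

theorem agree_setRel {k i : ℕ} (h : ∀ v ∈ S \ {SOVar.rel k i}, V.Agree V' v)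
    (R : (Fin k → M) → Prop) : ∀ v ∈ S, (V.setRel k i R).Agree (V'.setRel k i R) v := by
  intro v hv
  by_cases hx : v = SOVar.rel k i
  · subst hx; simp [Agree, setRel]
  · have := h v ⟨hv, hx⟩
    cases v with
    | rel k' i' =>
      by_cases hk : k' = k
      · subst hk
        simpa [Agree, setRel, show i' ≠ i by simpa using hx] using this
      · simpa [Agree, setRel, hk] using this
    | ind | fn => exact this

end SOVal

variable {M : Type w} [L.Structure M]

theorem SOTerm.eval_congr {V V' : SOVal M} (t : SOTerm L) (h : ∀ v ∈ t.vars, V.Agree V' v) :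
    t.eval V = t.eval V' := by
  induction t with
  | var x => exact h _ rfl
  | func f ts ih =>
    simp only [eval]
    congr 1
    ext j
    exact ih j fun v hv => h v (Set.mem_iUnion.2 ⟨j, hv⟩)
  | fnVar k i ts ih =>
    simp only [eval]
    rw [show V.fn k i = V'.fn k i from h _ (Or.inl rfl)]
    congr 1
    ext j
    exact ih j fun v hv => h v (Or.inr (Set.mem_iUnion.2 ⟨j, hv⟩))

theorem SOFormula.realize_congr {V V' : SOVal M} (φ : SOFormula L)
    (h : ∀ v ∈ φ.freeVars, V.Agree V' v) : φ.Realize V ↔ φ.Realize V' := by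
  induction φ generalizing V V' with
  | eq t₁ t₂ =>
    simp only [Realize]
    rw [t₁.eval_congr fun v hv => h v (Or.inl hv), t₂.eval_congr fun v hv => h v (Or.inr hv)]
  | rel R ts =>
    simp only [Realize]
    simp only [fun j => (ts j).eval_congr fun v hv => h v (Set.mem_iUnion.2 ⟨j, hv⟩)]
  | relVar k i ts =>
    simp only [Realize]
    rw [show V.rel k i = V'.rel k i from h _ (Or.inl rfl)]
    simp only [fun j => (ts j).eval_congr fun v hv => h v (Or.inr (Set.mem_iUnion.2 ⟨j, hv⟩))]
  | not φ ih => exact not_congr (ih h)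
  | and φ ψ ih₁ ih₂ =>
    exact and_congr (ih₁ fun v hv => h v (Or.inl hv)) (ih₂ fun v hv => h v (Or.inr hv))
  | or φ ψ ih₁ ih₂ =>
    exact or_congr (ih₁ fun v hv => h v (Or.inl hv)) (ih₂ fun v hv => h v (Or.inr hv))
  | imp φ ψ ih₁ ih₂ =>
    exact imp_congr (ih₁ fun v hv => h v (Or.inl hv)) (ih₂ fun v hv => h v (Or.inr hv))
  | all x φ ih => exact forall_congr' fun a => ih (SOVal.agree_setInd h a)
  | ex x φ ih => exact exists_congr fun a => ih (SOVal.agree_setInd h a)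
  | allFn k i φ ih => exact forall_congr' fun F => ih (SOVal.agree_setFn h F)
  | exFn k i φ ih => exact exists_congr fun F => ih (SOVal.agree_setFn h F)
  | allRel k i φ ih => exact forall_congr' fun R => ih (SOVal.agree_setRel h R)
  | exRel k i φ ih => exact exists_congr fun R => ih (SOVal.agree_setRel h R)

/-- Truth refers to all valuations, whereas the team supplies one decoded valuation; for a sentence
one is enough. -/
theorem SOFormula.IsSentence.trueIn_iff {φ : SOFormula L} (hφ : φ.IsSentence) (V : SOVal M) :
    φ.TrueIn M ↔ φ.Realize V :=
  ⟨fun h => h V, fun h V' => (φ.realize_congr fun v hv => by rw [hφ] at hv; exact hv.elim).1 h⟩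

end TeamLogic

/-- Every second-order sentence is expressible in intuitionistic dependence logic. -/
theorem mainTheorem2 (L : FirstOrder.Language.{u, v}) (ψ : TeamLogic.SOFormula L)
    (hψ : ψ.IsSentence) :
    ∃ φ : TeamLogic.BIDFormula L, φ.IsID ∧ φ.IsSentence ∧
      ∀ (M : Type w) [L.Structure M] [Nonempty M], ψ.TrueIn M ↔ φ.TrueIn M := by
  obtain ⟨φ, hID, hfree, hφ⟩ := (ψ.expressible fun _ _ => true).1
  have hs : φ.IsSentence := by
    rw [hψ] at hfree
    refine Set.subset_eq_empty hfree ?_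
    ext x
    simp [TeamLogic.Slot.varsOf, TeamLogic.slotsOf]
  refine ⟨φ, hID, hs, fun M _ _ => ?_⟩
  -- Any slot valuation would do, as would any initial flags, since no variable is free.
  let W : TeamLogic.SlotVal M := fun _ _ => Classical.arbitrary M
  rw [TeamLogic.BIDFormula.trueIn_iff_totalSat hID hs W.team_nonempty, hφ M W]
  exact hψ.trueIn_iff _
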